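/- Let $G$ be a group without elements of order two and let $M$ be a $G$-module. \emph{Cohomology.} Let $C^n(G,M)$ be the group of all functions $G^n\to M$, with the usual inhomogeneous coboundary $d^n$, and $H^n(G,M)$ its cohomology. The adjacent transpositions $\tau_i=(i,i+1)$, $1\le i\le n$, of $\Sigma_{n+1}$ act on $C^n(G,M)$ by $(\tau_1\phi)(g_1,\dots,g_n)=-g_1\phi(g_1^{-1},g_1g_2,g_3,\dots,g_n)$, $(\tau_i\phi)(g_1,\dots,g_n)=-\phi(g_1,\dots,g_{i-2},g_{i-1}g_i,g_i^{-1},g_ig_{i+1},\dots,g_n)$ for $1<i<n$, and $(\tau_n\phi)(g_1,\dots,g_n)=-\phi(g_1,\dots,g_{n-1}g_n,g_n^{-1})$ for $n>1$. The invariants form a subcomplex $CS^*(G,M)\subset C^*(G,M)$; its cohomology is the symmetric cohomology $HS^*(G,M)$, and the inclusion induces $\alpha^n:HS^n(G,M)\to H^n(G,M)$. \emph{Crossed extensions.} A crossed extension of $G$ by $M$ is an exact sequence $0\to M\to T\xrightarrow{\partial}R\xrightarrow{p}G\to 0$ in which $\partial$ is a crossed module inducing the given action of $G$ on $M$; morphisms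 are morphisms of crossed modules that are compatible with the sequences and are the identity on $M$ and $G$. $\mathsf{Xext}(G,M)$ is the class of connected components of this category. An $s$-section is a pair of maps $s:G\to R$, $\sigma:G\times G\to T$ with $ps(x)=x$ and $s(x)s(y)=\partial(\sigma(x,y))s(xy)$; it has a $3$-cocycle $f_{s,\sigma}\in C^3(G,M)$ given by $$f_{s,\sigma}(x,y,z)={}^{s(x)}\sigma(y,z)\,\sigma(x,yz)\,\sigma(xy,z)^{-1}\,\sigma(x,y)^{-1}.$$ An $s$-section is symmetric if it is normalised ($s(1)=1$, $\sigma(1,x)=1=\sigma(x,1)$), weakly symmetric ($s(x^{-1})=s(x)^{-1}$, $\sigma(x,x^{-1})=1$), and satisfies $$\sigma(x,y)\cdot{}^{s(x)}\sigma(x^{-1},xy)=1,\qquad \sigma(x,y)\cdot\sigma(xy,y^{-1})=1\qquad(x,y\in G).$$ A crossed extension is symmetric if it has a symmetric $s$-section, and $\mathsf{XextS}(G,M)\subset\mathsf{Xext}(G,M)$ is the subset of classes of symmetric crossed extensions. \emph{Theorem.} There is a natural bijection $$\Phi:HS^3(G,M)\;\cong\;\mathsf{XextS}(G,M),$$ namely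 the one compatible with $\alpha^3$ and with the classification of crossed extensions by $H^3(G,M)$: for every $a\in HS^3(G,M)$, every crossed extension $E$ of $G$ by $M$ and every $s$-section $(s,\sigma)$ of $E$, one has $\Phi(a)=[E]$ in $\mathsf{Xext}(G,M)$ if and only if $\alpha^3(a)=[f_{s,\sigma}]$ in $H^3(G,M)$. -/

import Mathlib

universe u v

namespace SymmetricCohomology

section Cohomology

variable (G : Type u) [Group G] (M : Type v) [AddCommGroup M] [DistribMulAction G M]

/-- The group `Cⁿ(G, M)` of (inhomogeneous) `n`-cochains: all functions `Gⁿ → M`. -/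
abbrev Cochain (G : Type u) (M : Type v) (n : ℕ) : Type (max u v) := (Fin n → G) → M

/-- The coboundary map `dⁿ : Cⁿ(G, M) → Cⁿ⁺¹(G, M)`. For `j < n`, `Fin.contractNth j (· * ·) g`
replaces the adjacent entries `g j`, `g (j + 1)` by their product; for `j = n` it drops the last
entry. (This is the formula of Mathlib's `inhomogeneousCochains.d`, which over `ℤ` is only
available for groups in `Type`.) -/
def d (n : ℕ) : Cochain G M n →+ Cochain G M (n + 1) where
  toFun f g := g 0 • f (fun i => g i.succ) +
    ∑ j : Fin (n + 1), (-1 : ℤ) ^ ((j : ℕ) + 1) • f (Fin.contractNth j (· * ·) g)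
  map_zero' := by
    ext g
    simp
  map_add' f f' := by
    ext g
    simp only [Pi.add_apply, smul_add, Finset.sum_add_distrib]
    abel

/-- The `n`-cocycles. -/
def cocycles (n : ℕ) : AddSubgroup (Cochain G M n) := (d G M n).ker

/-- The `n`-coboundaries. -/
def coboundaries : (n : ℕ) → AddSubgroup (Cochain G M n)
  | 0 => ⊥
  | n + 1 => (d G M n).range

/-- The cohomology group `Hⁿ(G, M)`. -/
abbrev H (n : ℕ) : Type (max u v) :=
  cocycles G M n ⧸ (coboundaries G M n).addSubgroupOf (cocycles G M n)

variable {G} in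
/-- The tuple obtained from `(g₁, …, gₙ)` by replacing the `i`-th entry by its inverse, the entry
before it (if any) by `gᵢ₋₁ gᵢ` and the entry after it (if any) by `gᵢ gᵢ₊₁`. -/
def twist {n : ℕ} (i : Fin n) (g : Fin n → G) : Fin n → G := fun j =>
  if (j : ℕ) = i then (g i)⁻¹
  else if (j : ℕ) + 1 = i then g j * g i
  else if (j : ℕ) = i + 1 then g i * g j
  else g j

/-- The action on `Cⁿ(G, M)` of the `i`-th adjacent transposition of `Σₙ₊₁` (indices start at `0`
here, so that `i = 0` is the transposition `(1, 2)`, the only one that involves the action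
of `G` on `M`). -/
def τ {n : ℕ} (i : Fin n) : Cochain G M n →+ Cochain G M n where
  toFun φ g := -(if (i : ℕ) = 0 then g i • φ (twist i g) else φ (twist i g))
  map_zero' := by
    ext g
    simp
  map_add' φ ψ := by
    ext g
    simp only [Pi.add_apply, smul_add]
    split_ifs <;> abel

/-- The symmetric cochains `CSⁿ(G, M)`: the cochains invariant under `Σₙ₊₁`, that is, under all
adjacent transpositions. -/
def symmetricCochains (n : ℕ) : AddSubgroup (Cochain G M n) :=
  ⨅ i : Fin n, (τ G M i).eqLocus (AddMonoidHom.id _)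

/-- The `n`-cocycles of the complex of symmetric cochains. -/
def symmetricCocycles (n : ℕ) : AddSubgroup (Cochain G M n) :=
  symmetricCochains G M n ⊓ cocycles G M n

/-- The `n`-coboundaries of the complex of symmetric cochains: coboundaries *of symmetric*
cochains. -/
def symmetricCoboundaries : (n : ℕ) → AddSubgroup (Cochain G M n)
  | 0 => ⊥
  | n + 1 => (symmetricCochains G M n).map (d G M n)

/-- The symmetric cohomology group `HSⁿ(G, M)`. -/
abbrev HS (n : ℕ) : Type (max u v) :=
  symmetricCocycles G M n ⧸ (symmetricCoboundaries G M n).addSubgroupOf (symmetricCocycles G M n)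

theorem symmetricCoboundaries_le (n : ℕ) : symmetricCoboundaries G M n ≤ coboundaries G M n := by
  cases n with
  | zero => exact le_rfl
  | succ n =>
    rintro _ ⟨f, -, rfl⟩
    exact ⟨f, rfl⟩

/-- The natural homomorphism `αⁿ : HSⁿ(G, M) → Hⁿ(G, M)` induced by the inclusion of symmetric
cochains into all cochains. -/
def α (n : ℕ) : HS G M n →+ H G M n :=
  QuotientAddGroup.map _ _ (AddSubgroup.inclusion (inf_le_right :
    symmetricCocycles G M n ≤ cocycles G M n)) (by
      intro x hx
      exact symmetricCoboundaries_le G M n hx)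

end Cohomology

/-- A crossed module: a group homomorphism `∂ : T → R` with an action of `R` on the group `T` by
automorphisms, equivariant for conjugation on `R` and satisfying the Peiffer identity. -/
structure CrossedModule (T : Type u) (R : Type v) [Group T] [Group R]
    [MulDistribMulAction R T] where
  /-- the homomorphism `∂` -/
  bd : T →* R
  bd_smul : ∀ (r : R) (t : T), bd (r • t) = r * bd t * r⁻¹
  bd_smul_eq : ∀ t s : T, bd t • s = t * s * t⁻¹

/-- A crossed extension of `G` by the `G`-module `M`: an exact sequence
`0 → M → T → R → G → 0` in which `∂ : T → R` is a crossed module whose induced action of `G`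
on `M` is the given one. -/
structure CrossedExtension (G : Type u) [Group G] (M : Type v) [AddCommGroup M]
    [DistribMulAction G M] where
  T : Type (max u v)
  R : Type (max u v)
  [groupT : Group T]
  [groupR : Group R]
  [action : MulDistribMulAction R T]
  /-- the crossed module `∂ : T → R` -/
  toCrossedModule : CrossedModule T R
  /-- the homomorphism `M → T` -/
  incl : Multiplicative M →* T
  /-- the homomorphism `p : R → G` -/
  proj : R →* G
  incl_injective : Function.Injective incl
  range_incl : incl.range = toCrossedModule.bd.ker
  range_bd : toCrossedModule.bd.range = proj.ker
  proj_surjective : Function.Surjective proj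
  smul_incl : ∀ (r : R) (m : M),
    r • incl (Multiplicative.ofAdd m) = incl (Multiplicative.ofAdd (proj r • m))

namespace CrossedExtension

attribute [instance] groupT groupR action

variable {G : Type u} [Group G] {M : Type v} [AddCommGroup M] [DistribMulAction G M]

/-- The homomorphism `∂ : T → R`. -/
abbrev bd (E : CrossedExtension G M) : E.T →* E.R := E.toCrossedModule.bd

/-- A morphism of crossed extensions: a morphism of crossed modules that induces the identity
on `M` and on `G`. -/
@[ext]
structure Hom (E E' : CrossedExtension G M) where
  φ : E.T →* E'.T
  ψ : E.R →* E'.R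
  ψ_bd : ∀ t : E.T, ψ (E.bd t) = E'.bd (φ t)
  φ_smul : ∀ (r : E.R) (t : E.T), φ (r • t) = ψ r • φ t
  φ_incl : ∀ m : Multiplicative M, φ (E.incl m) = E'.incl m
  proj_ψ : ∀ r : E.R, E'.proj (ψ r) = E.proj r

/-- The category **Xext**`(G, M)` of crossed extensions of `G` by `M`. -/
instance : CategoryTheory.Category (CrossedExtension G M) where
  Hom := Hom
  id E :=
    { φ := MonoidHom.id _
      ψ := MonoidHom.id _
      ψ_bd := fun _ => rfl
      φ_smul := fun _ _ => rfl
      φ_incl := fun _ => rfl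
      proj_ψ := fun _ => rfl }
  comp f g :=
    { φ := g.φ.comp f.φ
      ψ := g.ψ.comp f.ψ
      ψ_bd := fun t => by simp [f.ψ_bd, g.ψ_bd]
      φ_smul := fun r t => by simp [f.φ_smul, g.φ_smul]
      φ_incl := fun m => by simp [f.φ_incl, g.φ_incl]
      proj_ψ := fun r => by simp [f.proj_ψ, g.proj_ψ] }

/-- An `s`-section `(s, σ)` of a crossed extension. -/
structure SSection (E : CrossedExtension G M) where
  s : G → E.R
  σ : G → G → E.T
  proj_s : ∀ x : G, E.proj (s x) = x
  s_mul_s : ∀ x y : G, s x * s y = E.bd (σ x y) * s (x * y)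

namespace SSection

variable {E : CrossedExtension G M} (S : E.SSection)

/-- The `s`-section `(s, σ)` is normalised. -/
def IsNormalised : Prop :=
  S.s 1 = 1 ∧ ∀ x : G, S.σ 1 x = 1 ∧ S.σ x 1 = 1

/-- A weakly symmetric `s`-section. -/
def IsWeaklySymmetric : Prop :=
  S.IsNormalised ∧ (∀ x : G, S.s x⁻¹ = (S.s x)⁻¹) ∧ ∀ x : G, S.σ x x⁻¹ = 1

/-- A symmetric `s`-section. -/
def IsSymmetric : Prop :=
  S.IsWeaklySymmetric ∧
    (∀ x y : G, S.σ x y * (S.s x • S.σ x⁻¹ (x * y)) = 1) ∧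
    ∀ x y : G, S.σ x y * S.σ (x * y) y⁻¹ = 1

/-- The element `ˢ⁽ˣ⁾σ(y, z) σ(x, yz) σ(xy, z)⁻¹ σ(x, y)⁻¹` of `T`, which lies in the image of
`M`. -/
def obstruction (x y z : G) : E.T :=
  (S.s x • S.σ y z) * S.σ x (y * z) * (S.σ (x * y) z)⁻¹ * (S.σ x y)⁻¹

theorem bd_σ (x y : G) : E.bd (S.σ x y) = S.s x * S.s y * (S.s (x * y))⁻¹ := by
  rw [S.s_mul_s, mul_inv_cancel_right]

theorem exists_incl_eq (x y z : G) :
    ∃ m : M, E.incl (Multiplicative.ofAdd m) = S.obstruction x y z := by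
  have h : S.obstruction x y z ∈ E.incl.range := by
    rw [E.range_incl, MonoidHom.mem_ker, obstruction]
    change E.bd _ = 1
    have h1 : E.bd (S.s x • S.σ y z) = S.s x * E.bd (S.σ y z) * (S.s x)⁻¹ :=
      E.toCrossedModule.bd_smul _ _
    rw [map_mul, map_mul, map_mul, map_inv, map_inv, h1]
    simp only [bd_σ, mul_assoc x y z]
    group
  obtain ⟨m, hm⟩ := h
  exact ⟨Multiplicative.toAdd m, hm⟩

/-- The `3`-cochain `f` of an `s`-section `(s, σ)`: the value `f(x, y, z)` is the unique element
of `M` whose image in `T` is `ˢ⁽ˣ⁾σ(y, z) σ(x, yz) σ(xy, z)⁻¹ σ(x, y)⁻¹`. -/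
noncomputable def cochain : Cochain G M 3 := fun g =>
  (S.exists_incl_eq (g 0) (g 1) (g 2)).choose

theorem incl_cochain (g : Fin 3 → G) :
    E.incl (Multiplicative.ofAdd (S.cochain g)) = S.obstruction (g 0) (g 1) (g 2) :=
  (S.exists_incl_eq (g 0) (g 1) (g 2)).choose_spec

theorem incl_comm (m : Multiplicative M) (t : E.T) : E.incl m * t = t * E.incl m := by
  have h : E.bd (E.incl m) = 1 := by
    have : E.incl m ∈ E.incl.range := ⟨m, rfl⟩
    rwa [E.range_incl] at this
  have h2 := E.toCrossedModule.bd_smul_eq (E.incl m) t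
  change E.bd (E.incl m) • t = _ at h2
  rw [h, one_smul] at h2
  exact (eq_mul_inv_iff_mul_eq.mp h2).symm

theorem obstruction_mul (x y z : G) :
    (S.s x • S.σ y z) * S.σ x (y * z) = S.obstruction x y z * (S.σ x y * S.σ (x * y) z) := by
  simp only [obstruction]
  group

theorem obstruction_comm (x y z : G) (t : E.T) :
    S.obstruction x y z * t = t * S.obstruction x y z := by
  obtain ⟨m, hm⟩ := S.exists_incl_eq x y z
  rw [← hm, incl_comm]

theorem smul_smul_σ (x y : G) (t : E.T) :
    S.s x • S.s y • t = S.σ x y * (S.s (x * y) • t) * (S.σ x y)⁻¹ := by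
  have h := E.toCrossedModule.bd_smul_eq (S.σ x y) (S.s (x * y) • t)
  change E.bd (S.σ x y) • _ = _ at h
  rw [← h, smul_smul, smul_smul, S.s_mul_s]

theorem obstruction_cocycle (x y z w : G) :
    (S.s x • S.obstruction y z w) * S.obstruction x (y * z) w * S.obstruction x y z =
      S.obstruction (x * y) z w * S.obstruction x y (z * w) := by
  have key : (S.s x • S.obstruction y z w) * S.obstruction x (y * z) w * S.obstruction x y z *
        (S.σ x y * S.σ (x * y) z * S.σ (x * y * z) w) =
      S.obstruction (x * y) z w * S.obstruction x y (z * w) *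
        (S.σ x y * S.σ (x * y) z * S.σ (x * y * z) w) := by
    calc
      _ = (S.s x • S.obstruction y z w) * S.obstruction x (y * z) w *
            (S.obstruction x y z * (S.σ x y * S.σ (x * y) z)) * S.σ (x * y * z) w := by
          simp only [mul_assoc]
      _ = (S.s x • S.obstruction y z w) * ((S.s x • S.σ y z) *
            (S.obstruction x (y * z) w * (S.σ x (y * z) * S.σ (x * (y * z)) w))) := by
          rw [← obstruction_mul]
          simp only [mul_assoc]
          rw [← mul_assoc (S.obstruction x (y * z) w), obstruction_comm]
          simp only [mul_assoc]
      _ = (S.s x • ((S.s y • S.σ z w) * S.σ y (z * w))) * S.σ x (y * z * w) := by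
          rw [← obstruction_mul, S.obstruction_mul y z w]
          simp only [smul_mul', mul_assoc]
      _ = S.σ x y * (S.s (x * y) • S.σ z w) * (S.σ x y)⁻¹ *
            (S.obstruction x y (z * w) * (S.σ x y * S.σ (x * y) (z * w))) := by
          rw [← obstruction_mul, smul_mul', smul_smul_σ]
          simp only [mul_assoc]
      _ = S.obstruction x y (z * w) *
            (S.σ x y * ((S.s (x * y) • S.σ z w) * S.σ (x * y) (z * w))) := by
          rw [← mul_assoc _ (S.obstruction x y (z * w)), ← obstruction_comm]
          group
      _ = _ := by
          rw [obstruction_mul, ← mul_assoc (S.σ x y), ← obstruction_comm]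
          rw [S.obstruction_comm (x * y) z w (S.obstruction x y (z * w))]
          simp only [mul_assoc]
  exact mul_right_cancel key

theorem cochain_mem_cocycles : S.cochain ∈ cocycles G M 3 := by
  rw [cocycles, AddMonoidHom.mem_ker]
  ext g
  have h := S.obstruction_cocycle (g 0) (g 1) (g 2) (g 3)
  have e := fun x y z : G => S.incl_cochain ![x, y, z]
  simp only [Matrix.cons_val] at e
  have hs : ∀ m : M, S.s (g 0) • E.incl (Multiplicative.ofAdd m) =
      E.incl (Multiplicative.ofAdd (g 0 • m)) := fun m => by
    rw [E.smul_incl, S.proj_s]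
  simp only [← e, hs, ← map_mul, ← ofAdd_add] at h
  replace h := Multiplicative.ofAdd.injective (E.incl_injective h)
  have h0 : (fun i : Fin 3 => g i.succ) = ![g 1, g 2, g 3] := by
    ext i; fin_cases i <;> rfl
  have h1 : Fin.contractNth (0 : Fin 4) (· * ·) g = ![g 0 * g 1, g 2, g 3] := by
    ext i; fin_cases i <;> rfl
  have h2 : Fin.contractNth (1 : Fin 4) (· * ·) g = ![g 0, g 1 * g 2, g 3] := by
    ext i; fin_cases i <;> rfl
  have h3 : Fin.contractNth (2 : Fin 4) (· * ·) g = ![g 0, g 1, g 2 * g 3] := by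
    ext i; fin_cases i <;> rfl
  have h4 : Fin.contractNth (3 : Fin 4) (· * ·) g = ![g 0, g 1, g 2] := by
    ext i; fin_cases i <;> rfl
  change g 0 • S.cochain (fun i : Fin 3 => g i.succ) + ∑ j : Fin 4,
    (-1 : ℤ) ^ ((j : ℕ) + 1) • S.cochain (Fin.contractNth j (· * ·) g) = 0
  rw [Fin.sum_univ_four, h0, h1, h2, h3, h4]
  simp only [Fin.isValue, Fin.val_zero, Fin.val_one, Fin.val_two, show ((3 : Fin 4) : ℕ) = 3 from rfl]
  norm_num
  rw [← sub_eq_zero] at h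
  rw [← h]
  abel

/-- The `3`-cocycle of an `s`-section. -/
noncomputable def cocycle : cocycles G M 3 := ⟨S.cochain, S.cochain_mem_cocycles⟩

/-- The class in `H³(G, M)` of the `3`-cocycle of an `s`-section. -/
noncomputable def cohomologyClass : H G M 3 := QuotientAddGroup.mk S.cocycle

end SSection

/-- A crossed extension is symmetric if it has a symmetric `s`-section. -/
def IsSymmetric (E : CrossedExtension G M) : Prop :=
  ∃ S : E.SSection, S.IsSymmetric

end CrossedExtension

section Classes

variable (G : Type u) [Group G] (M : Type v) [AddCommGroup M] [DistribMulAction G M]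

/-- The class `Xext(G, M)` of connected components of the category of crossed extensions. -/
abbrev Xext : Type (max u v + 1) := 
  CategoryTheory.ConnectedComponents (CrossedExtension.{u, v} G M)

variable {G M} in
/-- The class of a crossed extension. -/
abbrev Xext.mk (E : CrossedExtension.{u, v} G M) : Xext.{u, v} G M :=
  CategoryTheory.ConnectedComponents.mk E

/-- The subset `XextS(G, M)` of classes of symmetric crossed extensions. -/
def XextS : Set (Xext.{u, v} G M) :=
  {c | ∃ E : CrossedExtension.{u, v} G M, E.IsSymmetric ∧ Xext.mk E = c}

end Classes

end SymmetricCohomology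

open SymmetricCohomology

/-!
The two sides are compared inside `H³(G, M)`: symmetric cohomology maps injectively to it by `α³`,
connected components of crossed extensions are classified by it, and the classes of symmetric
crossed extensions are exactly the image of `α³`.

*Injectivity* (`α_three_injective`). Cochains are written in homogeneous form, as equivariant
functions of `n + 1` vertices, so that symmetric cochains are the functions that change sign under
transpositions. A symmetric cocycle can be made to vanish on degenerate simplices by subtracting a
symmetric coboundary (`exists_isNormalised3_sub`). If such a cocycle is `dh`, then `h + dk` is
symmetric as soon as it vanishes on `(a, a, a)` and `(a, b, a)` (`exists_symmetric_d_eq`). This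
prescribes `k(a, b) + k(b, a)`, which an equivariant `k` can realise because no group element swaps
`a` and `b`.

*Realisation.* Let `I` be the module of functions `G → M`, which contains `M` as the constants. The
homogeneous form of a cocycle `f`, read as a function of its first vertex, is a `2`-cochain `ρ` in
`I` with coboundary `f` (`Primitive.ofCocycle`). Modulo `M` it is a `2`-cocycle, so it defines an
extension of `G` by `I / M`, and `0 → M → I → (I / M) ×_ρ G → G → 0` is a crossed extension with an
evident `s`-section of cocycle `f` (`Primitive.crossedExtension`). If `f` is symmetric and
normalised then so is `ρ`, and this `s`-section is symmetric. Conversely the cocycle of a symmetric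
`s`-section is symmetric (`cochain_mem_symmetricCochains`).

*Classification* (`mk_eq_mk_iff`). Every crossed extension `E` is connected to one of the abelian
ones just described, with the same cocycle. First pull `E` back to a free group mapping onto `R`. A
subgroup of a free group is free, so now `T → ∂T` splits and `M` is a retract of `T`. Since `I` is
coinduced, the retraction induces an equivariant homomorphism `Q : T → I` extending the inclusion
of `M`, and `Q` carries the crossed extension to the one defined by `ρ = Q ∘ σ`
(`exists_hom_primitive`). For the abelian crossed extensions everything is a computation with
cochains in `I`: two choices of `ρ` with cohomologous coboundaries differ, up to `M`, by a
`2`-cocycle in `I`, which is a coboundary because `I` is coinduced.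
-/

namespace SymmetricCohomology

/-! ### Homogeneous cochains in degrees two and three -/

section Homogeneous

variable {G : Type u} [Group G] {M : Type v} [AddCommGroup M] [DistribMulAction G M]

/-- The homogeneous form of a `2`-cochain. -/
def homog2 (f : Cochain G M 2) (a b c : G) : M := a • f ![a⁻¹ * b, b⁻¹ * c]

/-- The homogeneous form of a `3`-cochain. -/
def homog3 (f : Cochain G M 3) (a b c e : G) : M := a • f ![a⁻¹ * b, b⁻¹ * c, c⁻¹ * e]

theorem smul_homog2 (f : Cochain G M 2) (g a b c : G) :
    g • homog2 f a b c = homog2 f (g * a) (g * b) (g * c) := by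
  simp [homog2, mul_smul, mul_assoc]

theorem smul_homog3 (f : Cochain G M 3) (g a b c e : G) :
    g • homog3 f a b c e = homog3 f (g * a) (g * b) (g * c) (g * e) := by
  simp [homog3, mul_smul, mul_assoc]

theorem apply_eq_homog3 (f : Cochain G M 3) (g : Fin 3 → G) :
    f g = homog3 f 1 (g 0) (g 0 * g 1) (g 0 * g 1 * g 2) := by
  simp only [homog3, one_smul, inv_one, one_mul, inv_mul_cancel_left]
  congr 1
  ext i
  fin_cases i <;> rfl

theorem homog3_injective : Function.Injective (homog3 (G := G) (M := M)) := fun f f' h => by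
  ext g
  rw [apply_eq_homog3 f, apply_eq_homog3 f', h]

/-- Every equivariant function of three variables is the homogeneous form of a `2`-cochain. -/
theorem exists_homog2_eq {F : G → G → G → M}
    (hF : ∀ g a b c, g • F a b c = F (g * a) (g * b) (g * c)) :
    ∃ f : Cochain G M 2, homog2 f = F := by
  refine ⟨fun g => F 1 (g 0) (g 0 * g 1), ?_⟩
  ext a b c
  simp [homog2, hF]

theorem d_two_apply (f : Cochain G M 2) (x y z : G) :
    d G M 2 f ![x, y, z] = x • f ![y, z] - f ![x * y, z] + f ![x, y * z] - f ![x, y] := by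
  have h0 : (fun i : Fin 2 => ![x, y, z] i.succ) = ![y, z] := by
    ext i; fin_cases i <;> rfl
  have h1 : Fin.contractNth (0 : Fin 3) (· * ·) ![x, y, z] = ![x * y, z] := by
    ext i; fin_cases i <;> rfl
  have h2 : Fin.contractNth (1 : Fin 3) (· * ·) ![x, y, z] = ![x, y * z] := by
    ext i; fin_cases i <;> rfl
  have h3 : Fin.contractNth (2 : Fin 3) (· * ·) ![x, y, z] = ![x, y] := by
    ext i; fin_cases i <;> rfl
  change x • f (fun i : Fin 2 => ![x, y, z] i.succ) + ∑ j : Fin 3,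
    (-1 : ℤ) ^ ((j : ℕ) + 1) • f (Fin.contractNth j (· * ·) ![x, y, z]) = _
  rw [Fin.sum_univ_three, h0, h1, h2, h3]
  norm_num
  abel

theorem d_three_apply (f : Cochain G M 3) (x y z w : G) :
    d G M 3 f ![x, y, z, w] = x • f ![y, z, w] - f ![x * y, z, w] + f ![x, y * z, w]
      - f ![x, y, z * w] + f ![x, y, z] := by
  have h0 : (fun i : Fin 3 => ![x, y, z, w] i.succ) = ![y, z, w] := by
    ext i; fin_cases i <;> rfl
  have h1 : Fin.contractNth (0 : Fin 4) (· * ·) ![x, y, z, w] = ![x * y, z, w] := by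
    ext i; fin_cases i <;> rfl
  have h2 : Fin.contractNth (1 : Fin 4) (· * ·) ![x, y, z, w] = ![x, y * z, w] := by
    ext i; fin_cases i <;> rfl
  have h3 : Fin.contractNth (2 : Fin 4) (· * ·) ![x, y, z, w] = ![x, y, z * w] := by
    ext i; fin_cases i <;> rfl
  have h4 : Fin.contractNth (3 : Fin 4) (· * ·) ![x, y, z, w] = ![x, y, z] := by
    ext i; fin_cases i <;> rfl
  change x • f (fun i : Fin 3 => ![x, y, z, w] i.succ) + ∑ j : Fin 4,
    (-1 : ℤ) ^ ((j : ℕ) + 1) • f (Fin.contractNth j (· * ·) ![x, y, z, w]) = _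
  rw [Fin.sum_univ_four, h0, h1, h2, h3, h4]
  simp only [Fin.isValue, Fin.val_zero, Fin.val_one, Fin.val_two,
    show ((3 : Fin 4) : ℕ) = 3 from rfl]
  norm_num
  abel

theorem homog3_d (f : Cochain G M 2) (a b c e : G) :
    homog3 (d G M 2 f) a b c e =
      homog2 f b c e - homog2 f a c e + homog2 f a b e - homog2 f a b c := by
  simp [homog3, homog2, d_two_apply, smul_sub, smul_add, smul_smul, mul_assoc]

/-- The cocycle identity in homogeneous form. -/
theorem homog3_of_mem_cocycles {f : Cochain G M 3} (hf : f ∈ cocycles G M 3) (a b c e k : G) :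
    homog3 f b c e k - homog3 f a c e k + homog3 f a b e k - homog3 f a b c k
      + homog3 f a b c e = 0 := by
  have h := congrArg (a • ·) (congrFun ((AddMonoidHom.mem_ker).1 hf)
    ![a⁻¹ * b, b⁻¹ * c, c⁻¹ * e, e⁻¹ * k])
  simp only [d_three_apply] at h
  simpa [homog3, smul_sub, smul_add, smul_smul, mul_assoc] using h

theorem mem_symmetricCochains {n : ℕ} {f : Cochain G M n} :
    f ∈ symmetricCochains G M n ↔ ∀ (i : Fin n) (g : Fin n → G), τ G M i f g = f g := by
  simp only [symmetricCochains, AddSubgroup.mem_iInf]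
  exact forall_congr' fun i => funext_iff

/-- The symmetric `2`-cochains are those whose homogeneous form changes sign under adjacent
transpositions of the variables. -/
theorem mem_symmetricCochains_two {f : Cochain G M 2} :
    f ∈ symmetricCochains G M 2 ↔ ∀ a b c : G,
      homog2 f b a c = -homog2 f a b c ∧ homog2 f a c b = -homog2 f a b c := by
  have t0 (x y : G) : twist (0 : Fin 2) ![x, y] = ![x⁻¹, x * y] := by
    ext i; fin_cases i <;> rfl
  have t1 (x y : G) : twist (1 : Fin 2) ![x, y] = ![x * y, y⁻¹] := by
    ext i; fin_cases i <;> rfl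
  have e0 (x y : G) : τ G M (0 : Fin 2) f ![x, y] = -(x • f ![x⁻¹, x * y]) := by
    simp [τ, t0]
  have e1 (x y : G) : τ G M (1 : Fin 2) f ![x, y] = -f ![x * y, y⁻¹] := by
    simp [τ, t1]
  rw [mem_symmetricCochains]
  constructor
  · intro h a b c
    have h0 := h 0 ![a⁻¹ * b, b⁻¹ * c]
    have h1 := h 1 ![a⁻¹ * b, b⁻¹ * c]
    rw [e0] at h0
    rw [e1] at h1
    constructor
    · simp [homog2, ← h0, mul_assoc, smul_smul]
    · simp [homog2, ← h1, mul_assoc]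
  · intro h i g
    have hg : g = ![g 0, g 1] := by ext i; fin_cases i <;> rfl
    obtain ⟨h0, -⟩ := h 1 (g 0) (g 0 * g 1)
    obtain ⟨-, h1⟩ := h 1 (g 0) (g 0 * g 1)
    simp only [homog2, one_smul, inv_one, one_mul, mul_one, mul_inv_rev, mul_assoc,
      inv_mul_cancel_left, inv_mul_cancel] at h0 h1
    rw [hg]
    fin_cases i
    · exact (e0 _ _).trans (by rw [h0, neg_neg])
    · exact (e1 _ _).trans (by rw [h1, neg_neg])

theorem mem_symmetricCochains_three_iff {f : Cochain G M 3} :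
    f ∈ symmetricCochains G M 3 ↔ ∀ x y z : G,
      -(x • f ![x⁻¹, x * y, z]) = f ![x, y, z] ∧ -f ![x * y, y⁻¹, y * z] = f ![x, y, z] ∧
        -f ![x, y * z, z⁻¹] = f ![x, y, z] := by
  have t0 (x y z : G) : twist (0 : Fin 3) ![x, y, z] = ![x⁻¹, x * y, z] := by
    ext i; fin_cases i <;> rfl
  have t1 (x y z : G) : twist (1 : Fin 3) ![x, y, z] = ![x * y, y⁻¹, y * z] := by
    ext i; fin_cases i <;> rfl
  have t2 (x y z : G) : twist (2 : Fin 3) ![x, y, z] = ![x, y * z, z⁻¹] := by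
    ext i; fin_cases i <;> rfl
  have e0 (x y z : G) : τ G M (0 : Fin 3) f ![x, y, z] = -(x • f ![x⁻¹, x * y, z]) := by
    simp [τ, t0]
  have e1 (x y z : G) : τ G M (1 : Fin 3) f ![x, y, z] = -f ![x * y, y⁻¹, y * z] := by
    simp [τ, t1]
  have e2 (x y z : G) : τ G M (2 : Fin 3) f ![x, y, z] = -f ![x, y * z, z⁻¹] := by
    simp [τ, t2]
  rw [mem_symmetricCochains]
  refine ⟨fun h x y z => ⟨?_, ?_, ?_⟩, fun h i g => ?_⟩
  · rw [← e0, h]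
  · rw [← e1, h]
  · rw [← e2, h]
  · have hg : g = ![g 0, g 1, g 2] := by ext i; fin_cases i <;> rfl
    rw [hg]
    fin_cases i
    · exact (e0 _ _ _).trans (h _ _ _).1
    · exact (e1 _ _ _).trans (h _ _ _).2.1
    · exact (e2 _ _ _).trans (h _ _ _).2.2

/-- The symmetric `3`-cochains are those whose homogeneous form changes sign under adjacent
transpositions of the variables. -/
theorem mem_symmetricCochains_three {f : Cochain G M 3} :
    f ∈ symmetricCochains G M 3 ↔ ∀ a b c e : G,
      homog3 f b a c e = -homog3 f a b c e ∧ homog3 f a c b e = -homog3 f a b c e ∧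
        homog3 f a b e c = -homog3 f a b c e := by
  rw [mem_symmetricCochains_three_iff]
  constructor
  · intro h a b c e
    obtain ⟨h0, h1, h2⟩ := h (a⁻¹ * b) (b⁻¹ * c) (c⁻¹ * e)
    refine ⟨?_, ?_, ?_⟩
    · simp [homog3, ← h0, mul_assoc, smul_smul]
    · simp [homog3, ← h1, mul_assoc]
    · simp [homog3, ← h2, mul_assoc]
  · intro h x y z
    obtain ⟨h0, h1, h2⟩ := h 1 x (x * y) (x * (y * z))
    simp only [homog3, one_smul, inv_one, one_mul, mul_one, mul_inv_rev, mul_assoc,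
      inv_mul_cancel_left, inv_mul_cancel] at h0 h1 h2
    rw [h0, h1, h2, neg_neg]
    exact ⟨rfl, rfl, rfl⟩

theorem d_d_two (f : Cochain G M 2) : d G M 3 (d G M 2 f) = 0 := by
  ext g
  have hg : g = ![g 0, g 1, g 2, g 3] := by ext i; fin_cases i <;> rfl
  rw [hg]
  simp only [d_three_apply, d_two_apply, smul_sub, smul_add, smul_smul, mul_assoc, Pi.zero_apply]
  abel

end Homogeneous

/-! ### Injectivity of `α³` -/

section Injectivity

variable {G : Type u} [Group G] {M : Type v} [AddCommGroup M] [DistribMulAction G M]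

theorem d_mem_symmetricCochains_three {v : Cochain G M 2} (hv : v ∈ symmetricCochains G M 2) :
    d G M 2 v ∈ symmetricCochains G M 3 := by
  rw [mem_symmetricCochains_two] at hv
  rw [mem_symmetricCochains_three]
  intro a b c e
  simp only [homog3_d]
  refine ⟨?_, ?_, ?_⟩
  · rw [(hv a b e).1, (hv a b c).1]
    abel
  · rw [(hv b c e).1, (hv a b c).2]
    abel
  · rw [(hv b c e).2, (hv a c e).2]
    abel

/-- A `3`-cochain is normalised here if its homogeneous form vanishes when the first two vertices
agree; for a symmetric cochain it then vanishes on all degenerate simplices. Symmetry alone only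
gives that the values on degenerate simplices are killed by `2`. -/
def IsNormalised3 (f : Cochain G M 3) : Prop := ∀ a b c : G, homog3 f a a b c = 0

namespace IsNormalised3

variable {f : Cochain G M 3}

theorem apply_middle_eq (hn : IsNormalised3 f) (hs : f ∈ symmetricCochains G M 3)
    (a b c : G) : homog3 f a b b c = 0 := by
  rw [mem_symmetricCochains_three] at hs
  have h := (hs b a b c).1
  rw [(hs b b a c).2.1, hn] at h
  simpa using h

theorem apply_last_eq (hn : IsNormalised3 f) (hs : f ∈ symmetricCochains G M 3)
    (a b c : G) : homog3 f a b c c = 0 := by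
  have hm := hn.apply_middle_eq hs
  rw [mem_symmetricCochains_three] at hs
  have h := (hs a c b c).2.1
  rw [(hs a c c b).2.2, hm] at h
  simpa using h

theorem apply_first_third_eq (hn : IsNormalised3 f) (hs : f ∈ symmetricCochains G M 3)
    (a b c : G) : homog3 f a b a c = 0 := by
  rw [mem_symmetricCochains_three] at hs
  rw [(hs a a b c).2.1, hn, neg_zero]

theorem apply_second_last_eq (hn : IsNormalised3 f) (hs : f ∈ symmetricCochains G M 3)
    (a b c : G) : homog3 f a b c b = 0 := by
  have hm := hn.apply_middle_eq hs
  rw [mem_symmetricCochains_three] at hs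
  rw [(hs a b b c).2.2, hm, neg_zero]

end IsNormalised3

/-- Every symmetric `3`-cocycle `f` is normalised by a symmetric coboundary `dv`. The cocycle
identity gives `f(a, a, b, c) = u(a, b) + u(a, c)` for the function `u(a, b) = f(a, a, a, b)`, which
is killed by `2`; `v` takes the value `u(a, b)` on each permutation of `(a, a, b)`, and vanishes
on nondegenerate simplices. -/
theorem exists_isNormalised3_sub {f : Cochain G M 3} (hf : f ∈ symmetricCocycles G M 3) :
    ∃ v ∈ symmetricCochains G M 2, IsNormalised3 (f - d G M 2 v) := by
  classical
  obtain ⟨hs, hc⟩ := AddSubgroup.mem_inf.1 hf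
  rw [mem_symmetricCochains_three] at hs
  have hc := homog3_of_mem_cocycles hc
  have htwo (a b c : G) : -homog3 f a a b c = homog3 f a a b c := (hs a a b c).1.symm
  have hself (a : G) : homog3 f a a a a = 0 := by simpa using hc a a a a a
  have hsub (a b c : G) : homog3 f a a b c = homog3 f a a a c - homog3 f a a a b := by
    have h := hc a a a b c
    rw [← sub_eq_zero, ← h]
    abel
  obtain ⟨v, hv⟩ := exists_homog2_eq (M := M) (F := fun a b c : G =>
    if a = b then homog3 f a a a c else if b = c then homog3 f b b b a
      else if a = c then homog3 f a a a b else 0) (by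
    intro g a b c
    simp only [mul_right_inj, ← smul_homog3, smul_ite, smul_zero])
  refine ⟨v, ?_, ?_⟩
  · rw [mem_symmetricCochains_two, hv]
    intro a b c
    by_cases h1 : a = b
    · subst h1
      by_cases h2 : a = c
      · subst h2
        simp [hself]
      · simp [h2, Ne.symm h2, htwo]
    · by_cases h2 : b = c
      · subst h2
        simp [h1, Ne.symm h1, htwo]
      · by_cases h3 : a = c
        · subst h3
          simp [h1, Ne.symm h1, htwo]
        · simp [h1, h2, h3, Ne.symm h1, Ne.symm h2]
  · intro a b c
    have e : homog3 (f - d G M 2 v) a a b c = homog3 f a a b c - homog3 (d G M 2 v) a a b c := by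
      simp [homog3, smul_sub]
    rw [e, homog3_d, hv, hsub]
    simp only [if_true]
    abel

/-- In a group without elements of order two the pairs `{g, g⁻¹}` with `g ≠ 1` can be oriented. -/
theorem exists_positive (hG : ∀ g : G, orderOf g ≠ 2) :
    ∃ P : G → Prop, ∀ g, g ≠ 1 → (P g⁻¹ ↔ ¬P g) := by
  -- Call `g` positive if it precedes its inverse in a well-ordering of `G`.
  refine ⟨fun g => WellOrderingRel g g⁻¹, fun g hg => ?_⟩
  have hne : g ≠ g⁻¹ := fun h => hG g (orderOf_eq_prime (by rw [sq]; nth_rw 2 [h]; simp) hg)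
  simp only [inv_inv]
  rcases trichotomous_of WellOrderingRel g g⁻¹ with h | h | h
  · exact ⟨fun h' => absurd h' (asymm h), fun h' => absurd h h'⟩
  · exact absurd h hne
  · exact ⟨fun _ => asymm h, fun _ => h⟩

/-- If `dh` is symmetric and normalised, then `h` becomes symmetric after adding a coboundary `dk`:
`k` is chosen so that `h + dk` vanishes on `(a, a, a)` and on `(a, b, a)`. The values of `dh` on
degenerate simplices then show that it vanishes on all of them and changes sign under
transpositions. The choice of `k` with prescribed `k(a, b) + k(b, a)` is the one place where
elements of order two would obstruct. -/
theorem exists_symmetric_d_eq (hG : ∀ g : G, orderOf g ≠ 2) {h : Cochain G M 2}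
    (hs : d G M 2 h ∈ symmetricCochains G M 3) (hn : IsNormalised3 (d G M 2 h)) :
    ∃ h' ∈ symmetricCochains G M 2, d G M 2 h' = d G M 2 h := by
  classical
  obtain ⟨P, hP⟩ := exists_positive hG
  have n1 := hn
  have n3 := hn.apply_last_eq hs
  have n4 := hn.apply_first_third_eq hs
  have n5 := hn.apply_second_last_eq hs
  have m4 := n4
  simp only [IsNormalised3, homog3_d] at n1 n3 n4
  set H := homog2 h with hH
  have r1 (a b : G) : H a a b = H a a a := by
    have := n1 a a b
    rw [sub_self, zero_add, sub_eq_zero] at this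
    exact this
  have r2 (a b : G) : H a b b = H b b b := by
    have := n3 a b b
    rw [sub_add_cancel, sub_eq_zero] at this
    exact this.symm
  have r3 (a b : G) : H b a b + H b b b = H a b a + H a a a := by
    have := n4 a b b
    rw [r1 a b, r2 a b] at this
    rw [← sub_eq_zero, ← this]
    abel
  -- `k(a, a)` kills `H(a, a, a)`, and then `k(a, b) + k(b, a)` must cancel
  -- `H(a, b, a) + H(a, a, a)`, which is symmetric in `a` and `b` by `r3`; the whole of it goes to
  -- the positive pair.
  let k : G → G → M := fun a b =>
    if a = b then -H a a a else if P (a⁻¹ * b) then -(H a b a + H a a a) else 0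
  have hk (g a b : G) : g • k a b = k (g * a) (g * b) := by
    simp only [k, hH, smul_ite, smul_neg, smul_add, smul_homog2, smul_zero, mul_right_inj,
      mul_inv_rev, mul_assoc, inv_mul_cancel_left]
  have k1 (a : G) : k a a = -H a a a := by simp [k]
  have k2 (a b : G) (hab : a ≠ b) : k a b + k b a = -(H a b a + H a a a) := by
    have := hP (a⁻¹ * b) (by rwa [Ne, inv_mul_eq_one])
    rw [mul_inv_rev, inv_inv] at this
    by_cases hp : P (a⁻¹ * b)
    · simp [k, hab, hab.symm, this, hp]
    · simp [k, hab, hab.symm, this, hp, -neg_add_rev, r3 a b]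
  obtain ⟨h', hh'⟩ := exists_homog2_eq (M := M)
    (F := fun a b c : G => H a b c + (k b c - k a c + k a b)) (by
      intro g a b c
      simp only [smul_add, smul_sub, hk, hH, smul_homog2])
  have hd : d G M 2 h' = d G M 2 h := by
    apply homog3_injective
    ext a b c e
    simp only [homog3_d, hh', hH]
    abel
  have z1 (a : G) : homog2 h' a a a = 0 := by simp [hh', k1]
  have n (a b c e : G) : homog3 (d G M 2 h) a b c e =
      homog2 h' b c e - homog2 h' a c e + homog2 h' a b e - homog2 h' a b c := by
    rw [← hd, homog3_d]
  have z2 (a b : G) : homog2 h' a a b = 0 := by simp [hh', k1, r1 a b]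
  have z3 (a b : G) : homog2 h' a b b = 0 := by simp [hh', k1, r2 a b]
  have z4 (a b : G) : homog2 h' a b a = 0 := by
    by_cases hab : a = b
    · rw [← hab, z1]
    · have := k2 a b hab
      rw [hh']
      simp only [k1]
      rw [sub_neg_eq_add, add_right_comm, add_comm (k b a), this]
      abel
  refine ⟨h', ?_, hd⟩
  rw [mem_symmetricCochains_two]
  intro a b c
  constructor
  · have := n a b a c
    rw [m4, z2, z4] at this
    simpa [eq_neg_iff_add_eq_zero] using this.symm
  · have := n a b c b
    rw [n5, z3, z4] at this
    refine eq_neg_iff_add_eq_zero.2 (neg_eq_zero.1 (Eq.trans ?_ this.symm))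
    abel

theorem α_three_injective (hG : ∀ g : G, orderOf g ≠ 2) : Function.Injective (α G M 3) := by
  rw [injective_iff_map_eq_zero]
  intro a ha
  obtain ⟨⟨f, hf⟩, rfl⟩ := QuotientAddGroup.mk_surjective a
  obtain ⟨h, hh : d G M 2 h = f⟩ := (QuotientAddGroup.eq_zero_iff _).1 ha
  obtain ⟨v, hv, hn⟩ := exists_isNormalised3_sub hf
  have hd : d G M 2 (h - v) = f - d G M 2 v := by rw [map_sub, hh]
  rw [← hd] at hn
  obtain ⟨h', hs', hd'⟩ := exists_symmetric_d_eq hG (by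
    rw [hd]
    exact sub_mem (AddSubgroup.mem_inf.1 hf).1 (d_mem_symmetricCochains_three hv)) hn
  refine (QuotientAddGroup.eq_zero_iff _).2 ⟨h' + v, add_mem hs' hv, ?_⟩
  rw [map_add, hd', hd]
  exact sub_add_cancel _ _

end Injectivity

/-! ### Crossed extensions spliced from the coinduced module -/

section Coinduced

/-- The coinduced module: all functions `G → M`, with `(g • φ) w = g • φ (g⁻¹ * w)`. It is a type
synonym because Mathlib's action of `G` on `G → M` is the pointwise one. -/
def Coind (G : Type u) (M : Type v) : Type (max u v) := G → M

namespace Coind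

section Additive

variable {G : Type u} {M : Type v}

@[ext]
theorem ext {φ ψ : Coind G M} (h : ∀ w : G, φ w = ψ w) : φ = ψ := funext h

variable [AddCommGroup M]

instance : AddCommGroup (Coind G M) := inferInstanceAs (AddCommGroup (G → M))

@[simp] theorem zero_apply (w : G) : (0 : Coind G M) w = 0 := rfl
@[simp] theorem add_apply (φ ψ : Coind G M) (w : G) : (φ + ψ) w = φ w + ψ w := rfl
@[simp] theorem sub_apply (φ ψ : Coind G M) (w : G) : (φ - ψ) w = φ w - ψ w := rfl

/-- The inclusion of `M` into the coinduced module as the constant functions. -/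
def const : M →+ Coind G M where
  toFun m := fun _ => m
  map_zero' := rfl
  map_add' _ _ := rfl

theorem const_injective [Nonempty G] : Function.Injective (const : M →+ Coind G M) :=
  fun _ _ h => congrFun h (Classical.arbitrary G)

variable (G M) in
/-- The quotient of the coinduced module by the constant functions. -/
def Cosyzygy : Type (max u v) := Coind G M ⧸ (const : M →+ Coind G M).range

namespace Cosyzygy

instance : AddCommGroup (Cosyzygy G M) :=
  inferInstanceAs (AddCommGroup (Coind G M ⧸ (const : M →+ Coind G M).range))

/-- The projection from the coinduced module. -/
def proj : Coind G M →+ Cosyzygy G M := QuotientAddGroup.mk' _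

theorem proj_surjective : Function.Surjective (proj : Coind G M →+ Cosyzygy G M) :=
  QuotientAddGroup.mk'_surjective _

theorem proj_eq_zero_iff {φ : Coind G M} : proj φ = 0 ↔ ∃ m : M, const m = φ :=
  QuotientAddGroup.eq_zero_iff φ

@[simp] theorem proj_const (m : M) : proj (const m : Coind G M) = 0 :=
  proj_eq_zero_iff.2 ⟨m, rfl⟩

end Cosyzygy

end Additive

variable {G : Type u} [Group G] {M : Type v} [AddCommGroup M] [DistribMulAction G M]

instance : DistribMulAction G (Coind G M) where
  smul g φ := fun w => g • φ (g⁻¹ * w)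
  one_smul φ := by
    ext w
    change (1 : G) • φ (1⁻¹ * w) = φ w
    simp
  mul_smul g h φ := by
    ext w
    change (g * h) • φ ((g * h)⁻¹ * w) = g • h • φ (h⁻¹ * (g⁻¹ * w))
    simp [mul_smul, mul_assoc]
  smul_zero g := by
    ext w
    exact smul_zero g
  smul_add g φ ψ := by
    ext w
    exact smul_add g _ _

@[simp] theorem smul_apply (g : G) (φ : Coind G M) (w : G) : (g • φ) w = g • φ (g⁻¹ * w) := rfl

theorem smul_const (g : G) (m : M) : g • (const m : Coind G M) = const (g • m) := rfl

/-- The second cohomology of the coinduced module vanishes: evaluation at `1` turns the contracting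
homotopy of non-equivariant homogeneous cochains into a primitive of a `2`-cocycle. -/
theorem exists_primitive {c : G → G → Coind G M}
    (hc : ∀ x y z : G, x • c y z - c (x * y) z + c x (y * z) - c x y = 0) :
    ∃ l : G → Coind G M, ∀ x y : G, x • l y - l (x * y) + l x = c x y := by
  refine ⟨fun x => (fun w => w • (c w⁻¹ x) 1 : G → M), fun x y => ?_⟩
  ext w
  have h := congrArg (fun φ : Coind G M => w • φ 1) (hc w⁻¹ x y)
  simp only [add_apply, sub_apply, smul_apply, zero_apply, smul_sub, smul_add, smul_zero,
    smul_smul, mul_inv_cancel, one_smul, inv_inv, mul_one] at h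
  change x • ((x⁻¹ * w) • (c (x⁻¹ * w)⁻¹ y) 1) - w • (c w⁻¹ (x * y)) 1 + w • (c w⁻¹ x) 1 = c x y w
  rw [smul_smul, mul_inv_cancel_left, mul_inv_rev, inv_inv, ← sub_eq_zero, ← neg_eq_zero, ← h]
  abel

namespace Cosyzygy

instance : SMul G (Cosyzygy G M) where
  smul g := QuotientAddGroup.map _ _ (DistribSMul.toAddMonoidHom (Coind G M) g) (by
    rintro _ ⟨m, rfl⟩
    exact ⟨g • m, rfl⟩)

theorem smul_proj (g : G) (φ : Coind G M) : g • proj φ = proj (g • φ) := rfl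

instance : DistribMulAction G (Cosyzygy G M) where
  one_smul b := by
    obtain ⟨φ, rfl⟩ := proj_surjective b
    rw [smul_proj, one_smul]
  mul_smul g h b := by
    obtain ⟨φ, rfl⟩ := proj_surjective b
    simp only [smul_proj, mul_smul]
  smul_zero g := by
    rw [← map_zero proj, smul_proj, smul_zero]
  smul_add g b b' := by
    obtain ⟨φ, rfl⟩ := proj_surjective b
    obtain ⟨ψ, rfl⟩ := proj_surjective b'
    simp only [smul_proj, ← map_add, smul_add]

end Cosyzygy

end Coind

/-- A `3`-cochain `f` together with a `2`-cochain `ρ` in the coinduced module whose coboundary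
is `f`. (Such an `f` is automatically a cocycle.) -/
structure Primitive (G : Type u) [Group G] (M : Type v) [AddCommGroup M]
    [DistribMulAction G M] where
  /-- the `2`-cochain in the coinduced module -/
  ρ : G → G → Coind G M
  /-- its coboundary -/
  f : Cochain G M 3
  d_ρ : ∀ x y z : G, x • ρ y z - ρ (x * y) z + ρ x (y * z) - ρ x y = Coind.const (f ![x, y, z])

end Coinduced

open Coind Coind.Cosyzygy

namespace Primitive

variable {G : Type u} [Group G] {M : Type v} [AddCommGroup M] [DistribMulAction G M]

/-- The extension of `G` by the cosyzygy module defined by the `2`-cocycle `ρ` modulo `M`: pairs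
with the multiplication `(a, x)(b, y) = (a + x • b + ρ(x, y), xy)`. The cocycle need not be
normalised, so the unit is `(-ρ(1, 1), 1)`. -/
@[ext]
structure Extension (P : Primitive G M) where
  /-- the component in the kernel -/
  fst : Cosyzygy G M
  /-- the component in `G` -/
  snd : G

variable (P : Primitive G M)

/-- The `2`-cocycle `ρ` modulo `M`. -/
def θ (x y : G) : Cosyzygy G M := proj (P.ρ x y)

theorem θ_cocycle (x y z : G) : x • P.θ y z + P.θ x (y * z) = P.θ (x * y) z + P.θ x y := by
  have h := congrArg proj (P.d_ρ x y z)
  rw [proj_const, map_sub, map_add, map_sub, ← smul_proj] at h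
  rw [← sub_eq_zero, ← h]
  simp only [θ]
  abel

theorem θ_one_left (y : G) : P.θ 1 y = P.θ 1 1 := by
  have h := P.θ_cocycle 1 1 y
  simp only [one_smul, one_mul] at h
  exact add_left_cancel h

theorem θ_one_right (x : G) : P.θ x 1 = x • P.θ 1 1 := by
  have h := P.θ_cocycle x 1 1
  simp only [mul_one] at h
  exact (add_right_cancel h).symm

namespace Extension

variable {P}

instance : Mul P.Extension :=
  ⟨fun r r' => ⟨r.fst + r.snd • r'.fst + P.θ r.snd r'.snd, r.snd * r'.snd⟩⟩
instance : One P.Extension := ⟨⟨-P.θ 1 1, 1⟩⟩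
instance : Inv P.Extension :=
  ⟨fun r => ⟨-(r.snd⁻¹ • r.fst) - P.θ r.snd⁻¹ r.snd - P.θ 1 1, r.snd⁻¹⟩⟩

@[simp] theorem mul_fst (r r' : P.Extension) :
    (r * r').fst = r.fst + r.snd • r'.fst + P.θ r.snd r'.snd := rfl
@[simp] theorem mul_snd (r r' : P.Extension) : (r * r').snd = r.snd * r'.snd := rfl
@[simp] theorem one_fst : (1 : P.Extension).fst = -P.θ 1 1 := rfl
@[simp] theorem one_snd : (1 : P.Extension).snd = 1 := rfl
@[simp] theorem inv_fst (r : P.Extension) :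
    r⁻¹.fst = -(r.snd⁻¹ • r.fst) - P.θ r.snd⁻¹ r.snd - P.θ 1 1 := rfl
@[simp] theorem inv_snd (r : P.Extension) : r⁻¹.snd = r.snd⁻¹ := rfl

instance : Group P.Extension :=
  Group.ofLeftAxioms
    (fun a b c => by
      ext
      · have h := P.θ_cocycle a.snd b.snd c.snd
        rw [← sub_eq_zero] at h
        simp only [mul_fst, mul_snd, smul_add, mul_smul]
        rw [← sub_eq_zero, ← neg_eq_zero, ← h]
        abel
      · exact mul_assoc _ _ _)
    (fun a => by
      ext
      · simp [P.θ_one_left a.snd]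
      · simp)
    (fun a => by
      ext
      · simp only [mul_fst, inv_fst, inv_snd, one_fst]
        abel
      · simp)

/-- The projection onto `G`. -/
def sndHom : P.Extension →* G where
  toFun := snd
  map_one' := rfl
  map_mul' _ _ := rfl

instance : MulDistribMulAction P.Extension (Multiplicative (Coind G M)) where
  smul r t := .ofAdd (r.snd • t.toAdd)
  one_smul t := congrArg Multiplicative.ofAdd (one_smul G t.toAdd)
  mul_smul r r' t := congrArg Multiplicative.ofAdd (mul_smul r.snd r'.snd t.toAdd)
  smul_one r := congrArg Multiplicative.ofAdd (smul_zero (A := Coind G M) r.snd)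
  smul_mul r t t' := congrArg Multiplicative.ofAdd (smul_add r.snd t.toAdd t'.toAdd)

theorem toAdd_smul (r : P.Extension) (t : Multiplicative (Coind G M)) :
    (r • t).toAdd = r.snd • t.toAdd := rfl

variable (P) in
/-- The boundary map from the coinduced module. The term `ρ(1, 1)` makes `0` go to the unit of
the extension. -/
def bd : Multiplicative (Coind G M) →* P.Extension where
  toFun t := ⟨proj t.toAdd - P.θ 1 1, 1⟩
  map_one' := by
    ext <;> simp
  map_mul' t t' := by
    ext
    · simp
      abel
    · simp

@[simp] theorem bd_fst (t : Multiplicative (Coind G M)) :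
    (bd P t).fst = proj t.toAdd - P.θ 1 1 := rfl
@[simp] theorem bd_snd (t : Multiplicative (Coind G M)) : (bd P t).snd = 1 := rfl

theorem bd_mul_fst (t : Multiplicative (Coind G M)) (r : P.Extension) :
    (bd P t * r).fst = proj t.toAdd + r.fst := by
  simp [P.θ_one_left r.snd]
  abel

theorem bd_eq_one_iff {t : Multiplicative (Coind G M)} : bd P t = 1 ↔ proj t.toAdd = 0 := by
  constructor
  · intro h
    simpa using congrArg fst h
  · intro h
    ext
    · simp [h]
    · rfl

/-- The abelian crossed module of the Yoneda splice of `M → Coind G M → Cosyzygy G M` with the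
extension of `G` by the cosyzygy. -/
def crossedModule : CrossedModule (Multiplicative (Coind G M)) P.Extension where
  bd := bd P
  bd_smul r t := by
    rw [eq_mul_inv_iff_mul_eq]
    ext
    · rw [bd_mul_fst, toAdd_smul]
      rw [mul_fst, bd_fst, bd_snd, P.θ_one_right r.snd, smul_sub, smul_proj]
      abel
    · simp
  bd_smul_eq t t' := by
    rw [mul_right_comm, mul_inv_cancel, one_mul]
    exact congrArg Multiplicative.ofAdd (one_smul G t'.toAdd)

end Extension

open Extension

/-- The crossed extension of a primitive `(ρ, f)`. -/
def crossedExtension : CrossedExtension.{u, v} G M where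
  T := Multiplicative (Coind G M)
  R := P.Extension
  toCrossedModule := crossedModule
  incl := AddMonoidHom.toMultiplicative (const : M →+ Coind G M)
  proj := sndHom
  incl_injective := const_injective (G := G) (M := M)
  range_incl := by
    ext t
    rw [MonoidHom.mem_ker]
    change _ ↔ bd P t = 1
    rw [bd_eq_one_iff, proj_eq_zero_iff]
    exact Iff.rfl
  range_bd := by
    ext r
    constructor
    · rintro ⟨t, rfl⟩
      rfl
    · intro h
      obtain ⟨φ, hφ⟩ := proj_surjective (r.fst + P.θ 1 1)
      refine ⟨.ofAdd φ, ?_⟩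
      change bd P _ = r
      ext
      · simp [hφ]
      · exact h.symm
  proj_surjective x := ⟨⟨0, x⟩, rfl⟩
  smul_incl _ _ := rfl

/-- The tautological `s`-section of the crossed extension of a primitive. -/
def sSection : P.crossedExtension.SSection where
  s x := ⟨0, x⟩
  σ x y := .ofAdd (P.ρ x y)
  proj_s _ := rfl
  s_mul_s x y := by
    change (⟨0, x⟩ * ⟨0, y⟩ : P.Extension) =
      bd P (Multiplicative.ofAdd (P.ρ x y) : Multiplicative (Coind G M)) * ⟨0, x * y⟩
    ext
    · rw [bd_mul_fst]
      simp [θ]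
    · rw [mul_snd, mul_snd, bd_snd, one_mul]

/-- The component `σ` of an `s`-section, in additive notation. -/
def addσ {P : Primitive G M} (S : P.crossedExtension.SSection) (x y : G) : Coind G M :=
  Multiplicative.toAdd (S.σ x y : Multiplicative (Coind G M))

theorem d_addσ {P : Primitive G M} (S : P.crossedExtension.SSection) (x y z : G) :
    x • addσ S y z - addσ S (x * y) z + addσ S x (y * z) - addσ S x y =
      const (S.cochain ![x, y, z]) := by
  have h := S.incl_cochain ![x, y, z]
  have hs : Extension.snd (S.s x) = x := S.proj_s x
  change (const (S.cochain ![x, y, z]) : Coind G M) = Extension.snd (S.s x) • addσ S y z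
    + addσ S x (y * z) + -addσ S (x * y) z + -addσ S x y at h
  rw [h, hs]
  abel

theorem cochain_sSection : P.sSection.cochain = P.f := by
  ext g
  have hg : g = ![g 0, g 1, g 2] := by ext i; fin_cases i <;> rfl
  rw [hg]
  exact const_injective (G := G) ((d_addσ P.sSection _ _ _).symm.trans (P.d_ρ _ _ _))

/-- The crossed extension of a primitive `(ρ, f)` has class `[f]`: for every `s`-section, `σ` and
`ρ` differ by the coboundary of a lift `l` of the first component of `s`, up to an `M`-valued
cochain `h`. -/
theorem exists_cochain_eq_add_d (S : P.crossedExtension.SSection) :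
    ∃ h : Cochain G M 2, S.cochain = P.f + d G M 2 h := by
  -- `l` lifts the first component of `s`, and `h` is the discrepancy of `σ` and `ρ + dl`.
  choose l hl using fun x => proj_surjective (Extension.fst (S.s x))
  have hs (x : G) : Extension.snd (S.s x) = x := S.proj_s x
  have key (x y : G) : ∃ m : M,
      const m = addσ S x y - P.ρ x y - (x • l y - l (x * y) + l x) := by
    rw [← proj_eq_zero_iff]
    have h : Extension.fst (S.s x) + Extension.snd (S.s x) • Extension.fst (S.s y)
        + P.θ (Extension.snd (S.s x)) (Extension.snd (S.s y)) =
        proj (addσ S x y) + Extension.fst (S.s (x * y)) :=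
      (congrArg Extension.fst (S.s_mul_s x y)).trans (bd_mul_fst _ _)
    rw [hs, hs, ← hl, ← hl, ← hl, smul_proj, θ] at h
    simp only [map_sub, map_add]
    rw [← sub_eq_zero, ← neg_eq_zero] at h
    rw [← h]
    abel
  choose h hh using key
  refine ⟨fun g => h (g 0) (g 1), ?_⟩
  ext g
  have hg : g = ![g 0, g 1, g 2] := by ext i; fin_cases i <;> rfl
  rw [hg]
  apply const_injective (G := G)
  rw [Pi.add_apply, d_two_apply, map_add, ← d_addσ, ← P.d_ρ]
  simp only [map_sub, map_add, ← smul_const, Matrix.cons_val_zero, Matrix.cons_val_one, hh,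
    smul_sub, smul_add, smul_smul, mul_assoc]
  abel

/-- Primitives of cohomologous cocycles give crossed extensions related by a morphism: `ρ` and `ρ'`
differ, modulo `M`, by a `2`-cocycle in the coinduced module, hence by a coboundary. -/
theorem nonempty_hom {P P' : Primitive G M} {h : Cochain G M 2} (hf : P.f = P'.f + d G M 2 h) :
    Nonempty (P.crossedExtension ⟶ P'.crossedExtension) := by
  obtain ⟨l, hl⟩ := exists_primitive (c := fun x y => P.ρ x y - P'.ρ x y - const (h ![x, y]))
    (fun x y z => by
      have h1 := P.d_ρ x y z
      have h2 := P'.d_ρ x y z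
      rw [hf, Pi.add_apply, d_two_apply, map_add, ← h2, ← sub_eq_zero] at h1
      simp only [map_sub, map_add, ← smul_const] at h1
      simp only [smul_sub]
      rw [← h1]
      abel)
  have hθ (x y : G) : P.θ x y = P'.θ x y + (x • proj (l y) - proj (l (x * y)) + proj (l x)) := by
    have h := congrArg proj (hl x y)
    simp only [map_sub, map_add, proj_const, ← smul_proj] at h
    rw [h, θ, θ]
    abel
  have hone : P.θ 1 1 = P'.θ 1 1 + proj (l 1) := by
    rw [hθ, one_smul, mul_one]
    abel
  exact ⟨{
    φ := MonoidHom.id (Multiplicative (Coind G M))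
    ψ := ({
      toFun := fun r => ⟨r.fst + proj (l r.snd), r.snd⟩
      map_one' := by
        ext
        · simp [hone]
        · rfl
      map_mul' := fun r r' => by
        ext
        · simp only [mul_fst, mul_snd, hθ, smul_add]
          abel
        · rfl } : P.Extension →* P'.Extension)
    ψ_bd := fun (t : Multiplicative (Coind G M)) => by
      change (⟨(bd P t).fst + proj (l 1), 1⟩ : P'.Extension) = bd P' t
      ext
      · rw [bd_fst, bd_fst, hone, sub_add_eq_sub_sub, sub_add_cancel]
      · rfl
    φ_smul := fun _ _ => rfl
    φ_incl := fun _ => rfl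
    proj_ψ := fun _ => rfl }⟩

/-- The homogeneous form of a cocycle `f`, with the first vertex read as the argument of a function
on `G`, is a primitive of `f`. -/
def ofCocycle (f : Cochain G M 3) (hf : f ∈ cocycles G M 3) : Primitive G M where
  ρ x y := (fun w => homog3 f w 1 x (x * y) : G → M)
  f := f
  d_ρ x y z := by
    ext w
    have h := homog3_of_mem_cocycles hf w 1 x (x * y) (x * y * z)
    have h' : x • homog3 f (x⁻¹ * w) 1 y (y * z) - homog3 f w 1 (x * y) (x * y * z)
        + homog3 f w 1 x (x * (y * z)) - homog3 f w 1 x (x * y) = f ![x, y, z] := by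
      rw [smul_homog3, mul_inv_cancel_left, mul_one, apply_eq_homog3 f, ← sub_eq_zero,
        ← neg_eq_zero, ← h]
      simp only [Matrix.cons_val, mul_assoc]
      abel
    exact h'

theorem isSymmetric_sSection_ofCocycle {f : Cochain G M 3} (hf : f ∈ symmetricCocycles G M 3)
    (hn : IsNormalised3 f) : (ofCocycle f (AddSubgroup.mem_inf.1 hf).2).sSection.IsSymmetric := by
  have hs := (AddSubgroup.mem_inf.1 hf).1
  have hs3 := mem_symmetricCochains_three.1 hs
  set P := ofCocycle f (AddSubgroup.mem_inf.1 hf).2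
  have e (x y w : G) : P.ρ x y w = homog3 f w 1 x (x * y) := rfl
  have h1 (x : G) : P.ρ 1 x = 0 := by
    ext w
    rw [e, one_mul, hn.apply_middle_eq hs, Coind.zero_apply]
  have h2 (x : G) : P.ρ x 1 = 0 := by
    ext w
    rw [e, mul_one, hn.apply_last_eq hs, Coind.zero_apply]
  have h3 (x : G) : P.ρ x x⁻¹ = 0 := by
    ext w
    rw [e, mul_inv_cancel, hn.apply_second_last_eq hs, Coind.zero_apply]
  have hθ : P.θ 1 1 = 0 := by rw [θ, h1, map_zero]
  refine ⟨⟨⟨?_, fun x => ⟨?_, ?_⟩⟩, fun x => ?_, fun x => ?_⟩, fun x y => ?_, fun x y => ?_⟩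
  · change (⟨0, 1⟩ : P.Extension) = 1
    ext
    · rw [one_fst, hθ, neg_zero]
    · rfl
  · exact congrArg Multiplicative.ofAdd (h1 x)
  · exact congrArg Multiplicative.ofAdd (h2 x)
  · change (⟨0, x⁻¹⟩ : P.Extension) = ⟨0, x⟩⁻¹
    have hx : P.θ x⁻¹ x = 0 := by
      have := h3 x⁻¹
      rw [inv_inv] at this
      rw [θ, this, map_zero]
    ext
    · simp [hθ, hx]
    · rfl
  · exact congrArg Multiplicative.ofAdd (h3 x)
  · refine congrArg Multiplicative.ofAdd (?_ : P.ρ x y + x • P.ρ x⁻¹ (x * y) = 0)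
    ext w
    rw [Coind.add_apply, Coind.smul_apply, e, e, smul_homog3, mul_inv_cancel_left, mul_one,
      mul_inv_cancel, inv_mul_cancel_left, (hs3 w 1 x (x * y)).2.1, add_neg_cancel,
      Coind.zero_apply]
  · refine congrArg Multiplicative.ofAdd (?_ : P.ρ x y + P.ρ (x * y) y⁻¹ = 0)
    ext w
    rw [Coind.add_apply, e, e, mul_inv_cancel_right, (hs3 w 1 x (x * y)).2.2, add_neg_cancel,
      Coind.zero_apply]

end Primitive

/-! ### Free covers and the class of a crossed extension -/

namespace CrossedExtension

open CategoryTheory Coind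

variable {G : Type u} [Group G] {M : Type v} [AddCommGroup M] [DistribMulAction G M]

theorem bd_incl (E : CrossedExtension.{u, v} G M) (m : Multiplicative M) :
    E.bd (E.incl m) = 1 := by
  have : E.incl m ∈ E.incl.range := ⟨m, rfl⟩
  rwa [E.range_incl] at this

theorem exists_incl_eq_of_bd_eq_one (E : CrossedExtension.{u, v} G M) {t : E.T}
    (h : E.bd t = 1) : ∃ m : Multiplicative M, E.incl m = t := by
  have : t ∈ E.toCrossedModule.bd.ker := h
  rwa [← E.range_incl] at this

theorem proj_bd (E : CrossedExtension.{u, v} G M) (t : E.T) : E.proj (E.bd t) = 1 := by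
  have : E.bd t ∈ E.toCrossedModule.bd.range := ⟨t, rfl⟩
  rwa [E.range_bd] at this

theorem exists_bd_eq_of_proj_eq_one (E : CrossedExtension.{u, v} G M) {r : E.R}
    (h : E.proj r = 1) : ∃ t : E.T, E.bd t = r := by
  have : r ∈ E.proj.ker := h
  rwa [← E.range_bd] at this

theorem bd_smul (E : CrossedExtension.{u, v} G M) (r : E.R) (t : E.T) :
    E.bd (r • t) = r * E.bd t * r⁻¹ := E.toCrossedModule.bd_smul r t

theorem bd_smul_eq (E : CrossedExtension.{u, v} G M) (t t' : E.T) :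
    E.bd t • t' = t * t' * t⁻¹ := E.toCrossedModule.bd_smul_eq t t'

theorem nonempty_sSection (E : CrossedExtension.{u, v} G M) : Nonempty E.SSection := by
  choose s hs using E.proj_surjective
  have h (x y : G) : ∃ t : E.T, E.bd t = s x * s y * (s (x * y))⁻¹ :=
    E.exists_bd_eq_of_proj_eq_one (by simp [hs])
  choose σ hσ using h
  exact ⟨⟨s, σ, hs, fun x y => by rw [hσ, inv_mul_cancel_right]⟩⟩

namespace SSection

variable {E E' : CrossedExtension.{u, v} G M}

/-- The image of an `s`-section under a morphism. -/
def map (f : E ⟶ E') (S : E.SSection) : E'.SSection where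
  s x := Hom.ψ f (S.s x)
  σ x y := Hom.φ f (S.σ x y)
  proj_s x := by rw [Hom.proj_ψ f, S.proj_s]
  s_mul_s x y := by rw [← map_mul, S.s_mul_s, map_mul, Hom.ψ_bd f]

theorem cochain_map (f : E ⟶ E') (S : E.SSection) : (S.map f).cochain = S.cochain := by
  ext g
  apply Multiplicative.ofAdd.injective
  apply E'.incl_injective
  rw [incl_cochain, ← Hom.φ_incl f, incl_cochain]
  simp [obstruction, map, Hom.φ_smul f]

end SSection

section FreeCover

variable (E : CrossedExtension.{u, v} G M)

/-- The homomorphism from the free group on the set `R` onto `R`. -/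
def coverHom : FreeGroup E.R →* E.R := FreeGroup.lift id

/-- The pullback of `∂ : T → R` to the free group on the set `R`. -/
def pullbackT : Subgroup (E.T × FreeGroup E.R) :=
  (E.bd.comp (MonoidHom.fst _ _)).eqLocus (E.coverHom.comp (MonoidHom.snd _ _))

theorem mem_pullbackT {t : E.T × FreeGroup E.R} :
    t ∈ E.pullbackT ↔ E.bd t.1 = E.coverHom t.2 := Iff.rfl

instance : MulDistribMulAction (FreeGroup E.R) E.pullbackT where
  smul w t := ⟨(E.coverHom w • t.1.1, w * t.1.2 * w⁻¹), by
    have := E.mem_pullbackT.1 t.2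
    rw [mem_pullbackT, bd_smul, this]
    simp⟩
  one_smul t := by
    ext
    · change E.coverHom 1 • t.1.1 = t.1.1
      simp
    · change 1 * t.1.2 * 1⁻¹ = t.1.2
      simp
  mul_smul w w' t := by
    ext
    · change E.coverHom (w * w') • t.1.1 = E.coverHom w • E.coverHom w' • t.1.1
      rw [map_mul, mul_smul]
    · change (w * w') * t.1.2 * (w * w')⁻¹ = w * (w' * t.1.2 * w'⁻¹) * w⁻¹
      group
  smul_one w := by
    ext
    · change E.coverHom w • (1 : E.T) = 1
      simp
    · change w * 1 * w⁻¹ = 1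
      simp
  smul_mul w t t' := by
    ext
    · change E.coverHom w • (t.1.1 * t'.1.1) = (E.coverHom w • t.1.1) * (E.coverHom w • t'.1.1)
      simp
    · change w * (t.1.2 * t'.1.2) * w⁻¹ = (w * t.1.2 * w⁻¹) * (w * t'.1.2 * w⁻¹)
      group

/-- The pullback of a crossed extension to the free group on the underlying set of `R`. -/
def freeCover : CrossedExtension.{u, v} G M where
  T := E.pullbackT
  R := FreeGroup E.R
  toCrossedModule :=
    { bd := (MonoidHom.snd _ _).comp E.pullbackT.subtype
      bd_smul := fun _ _ => rfl
      bd_smul_eq := fun t t' => by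
        ext
        · change E.coverHom t.1.2 • t'.1.1 = t.1.1 * t'.1.1 * t.1.1⁻¹
          rw [← E.mem_pullbackT.1 t.2, bd_smul_eq]
        · rfl }
  incl := (E.incl.prod 1).codRestrict _ (fun m => by
    rw [mem_pullbackT]
    simp [bd_incl])
  proj := E.proj.comp E.coverHom
  incl_injective m m' h := E.incl_injective (congrArg (fun t => t.1.1) h)
  range_incl := by
    ext t
    constructor
    · rintro ⟨m, rfl⟩
      rfl
    · intro h
      replace h : t.1.2 = 1 := h
      obtain ⟨m, hm⟩ := E.exists_incl_eq_of_bd_eq_one (t := t.1.1) (by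
        rw [E.mem_pullbackT.1 t.2, h, map_one])
      exact ⟨m, Subtype.ext (Prod.ext hm h.symm)⟩
  range_bd := by
    ext w
    constructor
    · rintro ⟨t, rfl⟩
      change E.proj (E.coverHom t.1.2) = 1
      rw [← E.mem_pullbackT.1 t.2, proj_bd]
    · intro h
      obtain ⟨t, ht⟩ := E.exists_bd_eq_of_proj_eq_one (r := E.coverHom w) h
      exact ⟨⟨(t, w), ht⟩, rfl⟩
  proj_surjective x := by
    obtain ⟨r, hr⟩ := E.proj_surjective x
    exact ⟨FreeGroup.of r, by simp [coverHom, hr]⟩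
  smul_incl w m := by
    ext
    · exact E.smul_incl _ m
    · change w * 1 * w⁻¹ = 1
      simp

/-- The projection from the free cover. -/
def freeCoverHom : E.freeCover ⟶ E where
  φ := (MonoidHom.fst _ _).comp E.pullbackT.subtype
  ψ := E.coverHom
  ψ_bd t := (E.mem_pullbackT.1 t.2).symm
  φ_smul _ _ := rfl
  φ_incl _ := rfl
  proj_ψ _ := rfl

/-- Every `s`-section lifts to the free cover. -/
def SSection.lift {E : CrossedExtension.{u, v} G M} (S : E.SSection) : E.freeCover.SSection where
  s x := FreeGroup.of (S.s x)
  σ x y := ⟨(S.σ x y, FreeGroup.of (S.s x) * FreeGroup.of (S.s y) * (FreeGroup.of (S.s (x * y)))⁻¹),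
    by
      rw [mem_pullbackT]
      simp [coverHom, S.bd_σ]⟩
  proj_s x := by
    change E.proj (E.coverHom _) = x
    simp [coverHom, S.proj_s]
  s_mul_s x y := (inv_mul_cancel_right (FreeGroup.of (S.s x) * FreeGroup.of (S.s y))
    (FreeGroup.of (S.s (x * y)))).symm

theorem SSection.cochain_lift {E : CrossedExtension.{u, v} G M} (S : E.SSection) :
    S.lift.cochain = S.cochain := by
  rw [← cochain_map E.freeCoverHom S.lift]
  ext g
  apply Multiplicative.ofAdd.injective
  apply E.incl_injective
  rw [incl_cochain, incl_cochain]
  change E.coverHom (FreeGroup.of (S.s (g 0))) • S.σ (g 1) (g 2) * S.σ (g 0) (g 1 * g 2) *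
    (S.σ (g 0 * g 1) (g 2))⁻¹ * (S.σ (g 0) (g 1))⁻¹ = _
  rw [coverHom, FreeGroup.lift_apply_of]
  rfl

end FreeCover

section Linearisation

variable (E : CrossedExtension.{u, v} G M)

/-- If `R` is free then so is its subgroup `∂T`; hence `T → ∂T` splits, and the central subgroup `M`
is a retract of `T`. -/
theorem exists_retraction [IsFreeGroup E.R] :
    ∃ q : E.T →* Multiplicative M, ∀ m, q (E.incl m) = m := by
  have hfree : IsFreeGroup E.bd.range := subgroupIsFreeOfIsFree _
  let j : E.bd.range →* E.T := IsFreeGroup.lift fun a => (IsFreeGroup.of a).2.choose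
  have hj (r : E.bd.range) : E.bd (j r) = r := by
    have : E.bd.comp j = E.bd.range.subtype := IsFreeGroup.ext_hom fun a => by
      simpa [j] using (IsFreeGroup.of a).2.choose_spec
    exact DFunLike.congr_fun this r
  -- The retraction is `t ↦ t * (c t)⁻¹`, where `c` projects onto the image of the splitting.
  let c (t : E.T) : E.T := j (E.bd.rangeRestrict t)
  have hc (t : E.T) : ∃ m, E.incl m = t * (c t)⁻¹ :=
    E.exists_incl_eq_of_bd_eq_one (by
      rw [map_mul, map_inv, hj]
      simp)
  choose q hq using hc
  refine ⟨⟨⟨q, ?_⟩, ?_⟩, fun m => E.incl_injective ?_⟩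
  · apply E.incl_injective
    rw [hq]
    simp [c]
  · intro t t'
    apply E.incl_injective
    change E.incl (q (t * t')) = E.incl (q t * q t')
    have : c (t * t') = c t * c t' := by simp [c]
    rw [map_mul, hq t, mul_assoc, ← SSection.incl_comm, hq, hq, this]
    group
  · change E.incl (q (E.incl m)) = _
    have : E.bd.rangeRestrict (E.incl m) = 1 := Subtype.ext (E.bd_incl m)
    rw [hq]
    simp [c, this]

/-- A retraction `q` of `T` onto `M` induces, by the universal property of the coinduced module, an
equivariant homomorphism from `T` to it that extends the inclusion of the constants:
`t ↦ (w ↦ w • q(w̃⁻¹ • t))` for any lift `w̃` of `w` to `R`. -/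
theorem exists_linearisation {q : E.T →* Multiplicative M} (hq : ∀ m, q (E.incl m) = m) :
    ∃ Q : E.T →* Multiplicative (Coind G M),
      (∀ (r : E.R) (t : E.T), (Q (r • t)).toAdd = E.proj r • (Q t).toAdd) ∧
        ∀ m : M, Q (E.incl (.ofAdd m)) = .ofAdd (const m) := by
  choose l hl using E.proj_surjective
  -- `q` is invariant under `∂T`, which acts by inner automorphisms, since `M` is commutative.
  have hinv (r r' : E.R) (h : E.proj r = E.proj r') (t : E.T) : q (r • t) = q (r' • t) := by
    obtain ⟨u, hu⟩ := E.exists_bd_eq_of_proj_eq_one (r := r * r'⁻¹) (by simp [h])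
    rw [← inv_mul_cancel_right r r', ← hu, mul_smul, bd_smul_eq, map_mul, map_mul, map_inv,
      mul_right_comm, mul_inv_cancel, one_mul]
  refine ⟨⟨⟨fun t => .ofAdd (fun w => w • (q ((l w)⁻¹ • t)).toAdd : G → M), ?_⟩, ?_⟩, ?_, ?_⟩
  · refine congrArg Multiplicative.ofAdd (Coind.ext fun w => ?_)
    change w • (q ((l w)⁻¹ • 1)).toAdd = 0
    simp
  · intro t t'
    refine congrArg Multiplicative.ofAdd (Coind.ext fun w => ?_)
    change w • (q ((l w)⁻¹ • (t * t'))).toAdd =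
      w • (q ((l w)⁻¹ • t)).toAdd + w • (q ((l w)⁻¹ • t')).toAdd
    simp
  · intro r t
    ext w
    change w • (q ((l w)⁻¹ • r • t)).toAdd =
      E.proj r • ((E.proj r)⁻¹ * w) • (q ((l ((E.proj r)⁻¹ * w))⁻¹ • t)).toAdd
    rw [smul_smul (E.proj r), mul_inv_cancel_left, smul_smul, hinv _ (l ((E.proj r)⁻¹ * w))⁻¹]
    simp [hl]
  · intro m
    refine congrArg Multiplicative.ofAdd (Coind.ext fun w => ?_)
    change w • (q ((l w)⁻¹ • E.incl (.ofAdd m))).toAdd = m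
    rw [E.smul_incl, hq, toAdd_ofAdd, map_inv, hl, smul_inv_smul]

/-- A crossed extension with `R` free maps to the one of a primitive of the cocycle of any chosen
`s`-section `(s, σ)`: the primitive is `Q ∘ σ` for a linearisation `Q` of `T`, and the morphism is
`∂(t)s(x) ↦ (Q(t), x)` on `R`. -/
theorem exists_hom_primitive [IsFreeGroup E.R] (S : E.SSection) :
    ∃ P : Primitive G M, P.f = S.cochain ∧ Nonempty (E ⟶ P.crossedExtension) := by
  obtain ⟨q, hq⟩ := E.exists_retraction
  obtain ⟨Q, hQ, hQm⟩ := E.exists_linearisation hq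
  let P : Primitive G M :=
    { ρ := fun x y => (Q (S.σ x y)).toAdd
      f := S.cochain
      d_ρ := fun x y z => by
        have h := congrArg (fun t => (Q t).toAdd) (S.incl_cochain ![x, y, z])
        simp only [hQm, toAdd_ofAdd, SSection.obstruction, map_mul, map_inv, toAdd_mul, toAdd_inv,
          hQ, S.proj_s, Matrix.cons_val] at h
        rw [h]
        abel }
  have hex (r : E.R) : ∃ t : E.T, r = E.bd t * S.s (E.proj r) := by
    obtain ⟨t, ht⟩ := E.exists_bd_eq_of_proj_eq_one (r := r * (S.s (E.proj r))⁻¹) (by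
      simp [S.proj_s])
    exact ⟨t, by rw [ht, inv_mul_cancel_right]⟩
  choose t ht using hex
  let F (r : E.R) : P.Extension := ⟨Cosyzygy.proj (Q (t r)).toAdd, E.proj r⟩
  -- `F` does not depend on the choice of `t`, as `Q` maps `M` to the constants.
  have hF (r : E.R) (x : G) (t' : E.T) (h : r = E.bd t' * S.s x) :
      F r = ⟨Cosyzygy.proj (Q t').toAdd, x⟩ := by
    have hx : E.proj r = x := by rw [h, map_mul, proj_bd, one_mul, S.proj_s]
    subst hx
    have hb : E.bd (t r) = E.bd t' := mul_right_cancel ((ht r).symm.trans h)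
    obtain ⟨m, hm⟩ := E.exists_incl_eq_of_bd_eq_one (t := t r * t'⁻¹) (by
      rw [map_mul, map_inv, hb, mul_inv_cancel])
    have htr : t r = E.incl m * t' := by rw [hm, inv_mul_cancel_right]
    have hm' : (Q (E.incl m)).toAdd = const m.toAdd := congrArg Multiplicative.toAdd (hQm m.toAdd)
    simp only [F, htr, map_mul, toAdd_mul, map_add, hm', Cosyzygy.proj_const, zero_add]
  refine ⟨P, rfl, ⟨{
    φ := Q
    ψ := MonoidHom.mk' F fun r r' => ?_
    ψ_bd := fun u => ?_
    φ_smul := fun r u => ?_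
    φ_incl := fun m => hQm m.toAdd
    proj_ψ := fun _ => rfl }⟩⟩
  · rw [hF (r * r') (E.proj r * E.proj r')
      (t r * (S.s (E.proj r) • t r') * S.σ (E.proj r) (E.proj r'))]
    · apply Primitive.Extension.ext
      · simp only [map_mul, toAdd_mul, map_add, hQ, S.proj_s]
        rfl
      · rfl
    · rw [map_mul, map_mul, bd_smul, mul_assoc _ (E.bd _) (S.s _), ← S.s_mul_s]
      nth_rw 1 [ht r, ht r']
      group
  · change F (E.bd u) = Primitive.Extension.bd P (Q u)
    rw [hF _ 1 (u * (S.σ 1 1)⁻¹)]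
    · apply Primitive.Extension.ext
      · simp [P, Primitive.θ, sub_eq_add_neg]
      · rfl
    · have := S.s_mul_s 1 1
      rw [mul_one, mul_right_cancel_iff] at this
      rw [map_mul, map_inv, ← this, inv_mul_cancel_right]
  · exact congrArg Multiplicative.ofAdd (hQ r u)

end Linearisation

section Classification

theorem cohomologyClass_eq_iff {E E' : CrossedExtension.{u, v} G M} (S : E.SSection)
    (S' : E'.SSection) : S.cohomologyClass = S'.cohomologyClass ↔
      ∃ h : Cochain G M 2, S'.cochain = S.cochain + d G M 2 h := by
  rw [SSection.cohomologyClass, SSection.cohomologyClass, QuotientAddGroup.eq]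
  constructor
  · rintro ⟨h, hh : d G M 2 h = -S.cochain + S'.cochain⟩
    exact ⟨h, by rw [hh, add_neg_cancel_left]⟩
  · rintro ⟨h, hh⟩
    refine ⟨h, ?_⟩
    change d G M 2 h = -S.cochain + S'.cochain
    rw [hh, neg_add_cancel_left]

/-- The free cover of `E`, to which `s`-sections lift with the same cocycles, maps to the crossed
extension of a primitive. -/
theorem exists_primitive (E : CrossedExtension.{u, v} G M) (S : E.SSection) :
    ∃ P : Primitive G M, P.f = S.cochain ∧ Nonempty (E.freeCover ⟶ P.crossedExtension) := by
  have : IsFreeGroup E.freeCover.R := inferInstanceAs (IsFreeGroup (FreeGroup E.R))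
  obtain ⟨P, hP, hom⟩ := E.freeCover.exists_hom_primitive S.lift
  exact ⟨P, hP.trans S.cochain_lift, hom⟩

/-- The class of an `s`-section depends only on the crossed extension. Both `s`-sections are moved,
along the free cover, to the abelian crossed extension of a primitive, where all `s`-sections have
the same class. -/
theorem cohomologyClass_eq (E : CrossedExtension.{u, v} G M) (S S' : E.SSection) :
    S.cohomologyClass = S'.cohomologyClass := by
  obtain ⟨P, hP, ⟨f⟩⟩ := E.exists_primitive S
  obtain ⟨h, hh⟩ := P.exists_cochain_eq_add_d (S'.lift.map f)
  rw [SSection.cochain_map, SSection.cochain_lift, hP] at hh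
  exact (cohomologyClass_eq_iff S S').2 ⟨h, hh⟩

theorem cohomologyClass_eq_of_hom {E E' : CrossedExtension.{u, v} G M} (f : E ⟶ E')
    (S : E.SSection) (S' : E'.SSection) : S.cohomologyClass = S'.cohomologyClass := by
  rw [← E'.cohomologyClass_eq (S.map f) S', cohomologyClass_eq_iff]
  exact ⟨0, by rw [SSection.cochain_map, map_zero, add_zero]⟩

/-- Crossed extensions are classified by their class in `H³(G, M)`. -/
theorem mk_eq_mk_iff {E E' : CrossedExtension.{u, v} G M} (S : E.SSection) (S' : E'.SSection) :
    Xext.mk E = Xext.mk E' ↔ S.cohomologyClass = S'.cohomologyClass := by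
  refine ⟨fun h => ?_, fun h => Quotient.sound ?_⟩
  · replace h : Zigzag E E' := Quotient.exact h
    induction h with
    | refl => exact E.cohomologyClass_eq S S'
    | @tail E₁ E₂ _ hz ih =>
      obtain ⟨S₁⟩ := E₁.nonempty_sSection
      refine (ih S₁).trans ?_
      rcases hz with ⟨⟨f⟩⟩ | ⟨⟨f⟩⟩
      · exact cohomologyClass_eq_of_hom f S₁ S'
      · exact (cohomologyClass_eq_of_hom f S' S₁).symm
  · -- `E ← E.freeCover ⟶ P ⟶ P' ← E'.freeCover ⟶ E'`
    obtain ⟨k, hk⟩ := (cohomologyClass_eq_iff S' S).1 h.symm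
    obtain ⟨P, hP, ⟨f⟩⟩ := E.exists_primitive S
    obtain ⟨P', hP', ⟨f'⟩⟩ := E'.exists_primitive S'
    rw [← hP, ← hP'] at hk
    obtain ⟨g⟩ := Primitive.nonempty_hom hk
    exact (Zigzag.of_inv_hom E.freeCoverHom (f ≫ g)).trans
      (Zigzag.of_inv_hom f' E'.freeCoverHom)

end Classification

/-! ### Symmetric crossed extensions -/

section Symmetric

namespace SSection

/-- The cocycle of a symmetric `s`-section is a symmetric cochain. -/
theorem cochain_mem_symmetricCochains {E : CrossedExtension.{u, v} G M} {S : E.SSection}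
    (hS : S.IsSymmetric) : S.cochain ∈ symmetricCochains G M 3 := by
  obtain ⟨⟨-, hs, -⟩, hσ₁, hσ₂⟩ := hS
  have i₁ (x y : G) : S.s x • S.σ x⁻¹ (x * y) = (S.σ x y)⁻¹ := eq_inv_of_mul_eq_one_right (hσ₁ x y)
  have i₂ (x y : G) : S.σ (x * y) y⁻¹ = (S.σ x y)⁻¹ := eq_inv_of_mul_eq_one_right (hσ₂ x y)
  have incl (x y z : G) : E.incl (.ofAdd (S.cochain ![x, y, z])) = S.obstruction x y z :=
    S.incl_cochain ![x, y, z]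
  have neg {m m' : M} (h : E.incl (.ofAdd m) * E.incl (.ofAdd m') = 1) : -m' = m := by
    rw [← map_mul, ← ofAdd_add, ← map_one E.incl] at h
    exact (eq_neg_of_add_eq_zero_left (Multiplicative.ofAdd.injective (E.incl_injective h))).symm
  rw [mem_symmetricCochains_three_iff]
  -- The obstruction is central, so that it may be moved to the place where it cancels.
  refine fun x y z => ⟨neg ?_, neg ?_, neg ?_⟩
  · have h : S.s x • S.obstruction x⁻¹ (x * y) z = S.σ (x * y) z * (S.σ x (y * z))⁻¹ *
        (S.s x • S.σ y z)⁻¹ * S.σ x y := by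
      simp only [obstruction, smul_mul', smul_inv', hs, smul_inv_smul, inv_mul_cancel_left]
      rw [mul_assoc x y z, i₁, i₁, inv_inv]
    have hx : E.incl (.ofAdd (x • S.cochain ![x⁻¹, x * y, z])) =
        S.s x • S.obstruction x⁻¹ (x * y) z := by
      rw [← incl, E.smul_incl, S.proj_s]
    rw [hx, incl, h, ← mul_assoc, obstruction_comm, obstruction]
    group
  · have h : S.obstruction (x * y) y⁻¹ (y * z) = (S.σ x y)⁻¹ * (S.s x • S.σ y z)⁻¹ *
        (S.σ x y * S.σ (x * y) z * (S.σ x (y * z))⁻¹ * S.σ x y) := by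
      have h' := S.smul_smul_σ x y (S.σ y⁻¹ (y * z))
      rw [i₁, smul_inv'] at h'
      rw [obstruction, h', i₂, inv_mul_cancel_left, mul_inv_cancel_right]
      group
    rw [incl, incl, h, ← mul_assoc, obstruction_comm, obstruction]
    group
  · have h : S.obstruction x (y * z) z⁻¹ = (S.s x • S.σ y z)⁻¹ *
        (S.σ x y * S.σ (x * y) z * (S.σ x (y * z))⁻¹) := by
      rw [obstruction, i₂, smul_inv', mul_inv_cancel_right, ← mul_assoc x y z, i₂]
      group
    rw [incl, incl, h, ← mul_assoc, obstruction_comm, obstruction]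
    group

end SSection

theorem exists_HS_of_isSymmetric {E : CrossedExtension.{u, v} G M} {S : E.SSection}
    (hS : S.IsSymmetric) : ∃ a : HS G M 3, α G M 3 a = S.cohomologyClass :=
  ⟨QuotientAddGroup.mk ⟨S.cochain, AddSubgroup.mem_inf.2
    ⟨SSection.cochain_mem_symmetricCochains hS, S.cochain_mem_cocycles⟩⟩, rfl⟩

/-- Every symmetric class is realised by a symmetric crossed extension. -/
theorem exists_isSymmetric (a : HS G M 3) : ∃ (E : CrossedExtension.{u, v} G M) (S : E.SSection),
    S.IsSymmetric ∧ α G M 3 a = S.cohomologyClass := by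
  obtain ⟨⟨f, hf⟩, rfl⟩ := QuotientAddGroup.mk_surjective a
  obtain ⟨k, hk, hn⟩ := exists_isNormalised3_sub hf
  have hf' : f - d G M 2 k ∈ symmetricCocycles G M 3 :=
    sub_mem hf ⟨d_mem_symmetricCochains_three hk, d_d_two k⟩
  refine ⟨_, _, Primitive.isSymmetric_sSection_ofCocycle hf' hn, QuotientAddGroup.eq.2 ⟨-k, ?_⟩⟩
  change d G M 2 (-k) = -f + SSection.cochain _
  rw [Primitive.cochain_sSection, map_neg]
  change _ = -f + (f - d G M 2 k)
  abel

end Symmetric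

end CrossedExtension

end SymmetricCohomology

theorem mainTheorem1 {G : Type u} [Group G] {M : Type v} [AddCommGroup M] [DistribMulAction G M]
    (hG : ∀ g : G, orderOf g ≠ 2) :
    ∃ Φ : HS G M 3 ≃ XextS G M,
      ∀ (a : HS G M 3) (E : CrossedExtension G M) (S : E.SSection),
        (Φ a : Xext G M) = Xext.mk E ↔ α G M 3 a = S.cohomologyClass := by
  choose E S hS hα using CrossedExtension.exists_isSymmetric (G := G) (M := M)
  have hΦ (a : HS G M 3) (E' : CrossedExtension G M) (S' : E'.SSection) :
      Xext.mk (E a) = Xext.mk E' ↔ α G M 3 a = S'.cohomologyClass := by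
    rw [CrossedExtension.mk_eq_mk_iff (S a) S', hα]
  let Φ (a : HS G M 3) : XextS G M := ⟨Xext.mk (E a), E a, ⟨S a, hS a⟩, rfl⟩
  refine ⟨Equiv.ofBijective Φ ⟨fun a b hab => ?_, ?_⟩, hΦ⟩
  · apply α_three_injective hG
    rw [(hΦ a (E b) (S b)).1 (congrArg Subtype.val hab), hα]
  · rintro ⟨_, E', ⟨S', hS'⟩, rfl⟩
    obtain ⟨a, ha⟩ := CrossedExtension.exists_HS_of_isSymmetric hS'
    exact ⟨a, Subtype.ext ((hΦ a E' S').2 ha)⟩
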